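/- Let $\mathbb{N}_0=\{0,1,2,\dots\}$ and let $C_c(\mathbb{N}_0)$ be the space of finitely supported (real- or complex-valued) functions on $\mathbb{N}_0$. Let $\alpha\in[0,1)\cup[5,\infty)$. Then for all $u\in C_c(\mathbb{N}_0)$ with $u(0)=0$, $$\sum_{n=1}^\infty |u(n)-u(n-1)|^2\,n^\alpha \;\ge\; \frac{(\alpha-1)^2}{4}\sum_{n=1}^\infty \frac{|u(n)|^2}{n^2}\,n^\alpha .$$ Moreover, the constant $(\alpha-1)^2/4$ is sharp: for every such $\alpha$ and every real $C>\frac{(\alpha-1)^2}{4}$, the inequality with $\frac{(\alpha-1)^2}{4}$ replaced by $C$ fails for some $u\in C_c(\mathbb{N}_0)$ with $u(0)=0$. -/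

import Mathlib

open Filter Topology Finset

/-! The extremal profile is `n ^ g`, `g = (1 - α) / 2`. `norm_sub_sq_ge` is an equality when `y = t
* x`; taking `t` close to the profile's ratio of successive values bounds each energy term below by
multiples of `‖u (n + 1)‖ ^ 2` and `‖u n‖ ^ 2`. Summed, these telescope to the Hardy weight,
provided a scalar inequality holds: Bernoulli gives it for `0 ≤ α < 1`, a second-order Taylor bound
for `α ≥ 2`, which covers `α ≥ 5`. For sharpness, cut `n ^ g` off linearly on `[N, 2 * N]`. The
Hardy sum is at least `H_N`, the harmonic sum, and the energy is at most `B * H_N + O(1)` for any `B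
> g ^ 2`; since `H_N` diverges, no `C > g ^ 2` survives. -/

theorem norm_sub_sq_ge {𝕜 : Type*} [RCLike 𝕜] (x y : 𝕜) {t : ℝ} (ht : 0 < t) :
    (1 - t) * ‖x‖ ^ 2 - (t⁻¹ - 1) * ‖y‖ ^ 2 ≤ ‖x - y‖ ^ 2 := by
  have h1 : (‖x‖ - ‖y‖) ^ 2 ≤ ‖x - y‖ ^ 2 := by
    rw [← sq_abs (‖x‖ - ‖y‖)]
    exact pow_le_pow_left₀ (abs_nonneg _) (abs_norm_sub_norm_le x y) 2
  have h2 : (‖x‖ - ‖y‖) ^ 2 - ((1 - t) * ‖x‖ ^ 2 - (t⁻¹ - 1) * ‖y‖ ^ 2)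
      = t * (‖x‖ - t⁻¹ * ‖y‖) ^ 2 := by
    field_simp
    ring
  have h3 : 0 ≤ t * (‖x‖ - t⁻¹ * ‖y‖) ^ 2 := by positivity
  linarith

/-- The derivative of the difference is `p` times the Bernoulli gap for exponent `p - 1 ≥ 1`. -/
theorem one_add_mul_add_sq_le_rpow {x p : ℝ} (hx : 0 ≤ x) (hp : 2 ≤ p) :
    1 + p * x + p * (p - 1) / 2 * x ^ 2 ≤ (1 + x) ^ p := by
  let F : ℝ → ℝ := fun y => (1 + y) ^ p - (1 + p * y + p * (p - 1) / 2 * y ^ 2)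
  have hF : ∀ y ∈ Set.Ici (0 : ℝ), HasDerivAt F
      (p * ((1 + y) ^ (p - 1) - (1 + (p - 1) * y))) y := by
    intro y hy
    have hy' : (0 : ℝ) ≤ y := hy
    have h1 : HasDerivAt (fun y : ℝ => (1 + y) ^ p) (1 * p * (1 + y) ^ (p - 1)) y :=
      ((hasDerivAt_id y).const_add 1).rpow_const (Or.inl (by simp only [id]; positivity))
    have h2 : HasDerivAt (fun y : ℝ => 1 + p * y + p * (p - 1) / 2 * y ^ 2)
        (p * 1 + p * (p - 1) / 2 * (2 * y)) y := by
      have := ((hasDerivAt_id y).const_mul p).const_add 1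
      have h3 := (hasDerivAt_pow 2 y).const_mul (p * (p - 1) / 2)
      exact (this.add h3).congr_deriv (by norm_num)
    exact (h1.sub h2).congr_deriv (by ring)
  have hmono : MonotoneOn F (Set.Ici 0) := by
    refine monotoneOn_of_deriv_nonneg (convex_Ici 0)
      (fun y hy => (hF y hy).continuousAt.continuousWithinAt) ?_ ?_
    · intro y hy
      exact (hF y (interior_subset hy)).differentiableAt.differentiableWithinAt
    · intro y hy
      have hy' : (0 : ℝ) ≤ y := interior_subset hy
      rw [(hF y hy').deriv]
      have := one_add_mul_self_le_rpow_one_add (s := y) (by linarith) (p := p - 1) (by linarith)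
      exact mul_nonneg (by linarith) (by linarith)
  have h := hmono (Set.mem_Ici.2 le_rfl) (Set.mem_Ici.2 hx) hx
  simp only [F] at h
  norm_num at h
  linarith

theorem rpow_eq_mul_one_add_inv_rpow {m : ℝ} (hm : 0 < m) (α : ℝ) :
    (m + 1) ^ α = m ^ α * (1 + m⁻¹) ^ α := by
  rw [← Real.mul_rpow hm.le (by positivity)]
  congr 1
  field_simp

/-- A telescoping criterion for weighted discrete Hardy inequalities. -/
theorem hardy_of_telescoping {𝕜 : Type*} [RCLike 𝕜] (W V D : ℕ → ℝ) (u : ℕ →₀ 𝕜) (hu : u 0 = 0)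
    (h : ∀ n, V n * ‖u (n + 1)‖ ^ 2 + (D (n + 1) * ‖u (n + 1)‖ ^ 2 - D n * ‖u n‖ ^ 2)
      ≤ ‖u (n + 1) - u n‖ ^ 2 * W n) :
    ∑' n, V n * ‖u (n + 1)‖ ^ 2 ≤ ∑' n, ‖u (n + 1) - u n‖ ^ 2 * W n := by
  obtain ⟨N, hN⟩ : ∃ N, ∀ n, N ≤ n → u n = 0 := by
    refine ⟨u.support.sup id + 1, fun n hn => ?_⟩
    by_contra hne
    have := Finset.le_sup (f := id) (Finsupp.mem_support_iff.2 hne)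
    simp only [id] at this
    omega
  rw [tsum_eq_sum (s := range N), tsum_eq_sum (s := range N)]
  · have hs := Finset.sum_le_sum fun n (_ : n ∈ range N) => h n
    rw [Finset.sum_add_distrib, Finset.sum_range_sub (fun n => D n * ‖u n‖ ^ 2)] at hs
    simpa [hN N le_rfl, hu] using hs
  · intro n hn
    rw [Finset.mem_range, not_lt] at hn
    simp [hN n hn, hN (n + 1) (by omega)]
  · intro n hn
    rw [Finset.mem_range, not_lt] at hn
    simp [hN (n + 1) (by omega)]

theorem hardy_coeff_of_lt_one {b m : ℝ} (hb : 0 < b) (hb' : b ≤ 1 / 2) (hm : 1 ≤ m) :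
    b ^ 2 * m ^ (1 - 2 * b) / m ^ 2 + (m + 1) ^ (1 - 2 * b) * (b / m)
      ≤ m ^ (1 - 2 * b) * (b / (m - 1 + b)) := by
  have hm0 : 0 < m := by linarith
  have hB : (1 + m⁻¹) ^ (1 - 2 * b) ≤ 1 + (1 - 2 * b) * m⁻¹ :=
    rpow_one_add_le_one_add_mul_self (by have := inv_pos.2 hm0; linarith) (by linarith)
      (by linarith)
  have hW : 0 < m ^ (1 - 2 * b) := Real.rpow_pos_of_pos hm0 _
  rw [rpow_eq_mul_one_add_inv_rpow hm0]
  calc _ = m ^ (1 - 2 * b) * (b / m) * (b / m + (1 + m⁻¹) ^ (1 - 2 * b)) := by field_simp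
    _ ≤ m ^ (1 - 2 * b) * (b / m) * (b / m + (1 + (1 - 2 * b) * m⁻¹)) := by gcongr
    _ = m ^ (1 - 2 * b) * b * ((1 + (1 - b) / m) / m) := by field_simp; ring
    _ ≤ m ^ (1 - 2 * b) * b * (1 / (m - 1 + b)) := by
      refine mul_le_mul_of_nonneg_left ?_ (by positivity)
      rw [div_le_div_iff₀ hm0 (by linarith)]
      have : (1 + (1 - b) / m) * (m - 1 + b) = m - (1 - b) ^ 2 / m := by
        field_simp
        ring
      have h2 : 0 ≤ (1 - b) ^ 2 / m := by positivity
      linarith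
    _ = _ := by ring

theorem hardy_coeff_of_ge_two {b m : ℝ} (hb : 1 / 2 ≤ b) (hm : 0 < m) :
    b ^ 2 * m ^ (1 + 2 * b) / m ^ 2 + m ^ (1 + 2 * b) * (b / m)
      ≤ (m + 1) ^ (1 + 2 * b) * (b / (m + 1 + b)) := by
  have hB := one_add_mul_add_sq_le_rpow (x := m⁻¹) (p := 1 + 2 * b) (by positivity) (by linarith)
  have hW : 0 < m ^ (1 + 2 * b) := Real.rpow_pos_of_pos hm _
  rw [rpow_eq_mul_one_add_inv_rpow hm]
  -- The Taylor polynomial exceeds the product by exactly `b ^ 2 / m ^ 2`.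
  have key : (1 + b / m) * ((m + 1 + b) / m) ≤ (1 + m⁻¹) ^ (1 + 2 * b) := by
    refine le_trans ?_ hB
    have : 1 + (1 + 2 * b) * m⁻¹ + (1 + 2 * b) * (1 + 2 * b - 1) / 2 * m⁻¹ ^ 2
        - (1 + b / m) * ((m + 1 + b) / m) = b ^ 2 * m⁻¹ ^ 2 := by
      field_simp
      ring
    have h2 : 0 ≤ b ^ 2 * m⁻¹ ^ 2 := by positivity
    linarith
  calc _ = m ^ (1 + 2 * b) * ((1 + b / m) * ((m + 1 + b) / m)) * (b / (m + 1 + b)) := by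
        field_simp
        ring
    _ ≤ _ := by gcongr

theorem hardy_ineq_of_lt_one {𝕜 : Type*} [RCLike 𝕜] {b : ℝ} (hb : 0 < b) (hb' : b ≤ 1 / 2)
    (u : ℕ →₀ 𝕜) (hu : u 0 = 0) :
    ∑' n : ℕ, (b ^ 2 * ((n : ℝ) + 1) ^ (1 - 2 * b) / ((n : ℝ) + 1) ^ 2) * ‖u (n + 1)‖ ^ 2
      ≤ ∑' n : ℕ, ‖u (n + 1) - u n‖ ^ 2 * ((n : ℝ) + 1) ^ (1 - 2 * b) := by
  refine hardy_of_telescoping _ _ (fun n => ((n : ℝ) + 1) ^ (1 - 2 * b) * (b / n)) u hu fun n => ?_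
  have hc := hardy_coeff_of_lt_one (m := (n : ℝ) + 1) hb hb' (by simp)
  have hc' := mul_le_mul_of_nonneg_right hc (sq_nonneg ‖u (n + 1)‖)
  have hW : 0 ≤ ((n : ℝ) + 1) ^ (1 - 2 * b) := by positivity
  push_cast
  -- At `n = 0` the ratio `t` would vanish; there `u 0 = 0` and `b / 0 = 0` leave only the
  -- coefficient bound.
  rcases Nat.eq_zero_or_pos n with rfl | hn
  · simp only [Nat.cast_zero, zero_add, hu, sub_zero, sub_self, Real.one_rpow, div_zero,
      mul_zero, zero_mul] at hc' ⊢
    rw [div_self hb.ne'] at hc'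
    linarith
  · have hn' : (0 : ℝ) < n := by exact_mod_cast hn
    -- `t⁻¹ = 1 + b / n` imitates the growth of `n ^ b`.
    have hs := mul_le_mul_of_nonneg_right
      (norm_sub_sq_ge (u (n + 1)) (u n) (t := (n : ℝ) / (n + b)) (by positivity)) hW
    have e1 : 1 - (n : ℝ) / (n + b) = b / (n + 1 - 1 + b) := by
      rw [add_sub_cancel_right]
      field_simp
      ring
    have e2 : ((n : ℝ) / (n + b))⁻¹ - 1 = b / n := by
      field_simp
      ring
    rw [e1, e2] at hs
    linarith

theorem hardy_ineq_of_ge_two {𝕜 : Type*} [RCLike 𝕜] {b : ℝ} (hb : 1 / 2 ≤ b)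
    (u : ℕ →₀ 𝕜) (hu : u 0 = 0) :
    ∑' n : ℕ, (b ^ 2 * ((n : ℝ) + 1) ^ (1 + 2 * b) / ((n : ℝ) + 1) ^ 2) * ‖u (n + 1)‖ ^ 2
      ≤ ∑' n : ℕ, ‖u (n + 1) - u n‖ ^ 2 * ((n : ℝ) + 1) ^ (1 + 2 * b) := by
  refine hardy_of_telescoping _ _
    (fun n => -(((n : ℝ) + 1) ^ (1 + 2 * b) * (b / (n + 1 + b)))) u hu fun n => ?_
  have hm : (0 : ℝ) < (n : ℝ) + 1 := by positivity
  have hc := hardy_coeff_of_ge_two hb hm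
  have hc' := mul_le_mul_of_nonneg_right hc (sq_nonneg ‖u (n + 1)‖)
  have hW : 0 ≤ ((n : ℝ) + 1) ^ (1 + 2 * b) := by positivity
  -- Here the profile `n ^ (-b)` decays, so `t > 1` and `D` is negative.
  have hs := mul_le_mul_of_nonneg_right
    (norm_sub_sq_ge (u (n + 1)) (u n) (t := ((n : ℝ) + 1 + b) / (n + 1)) (by positivity)) hW
  have e1 : 1 - ((n : ℝ) + 1 + b) / (n + 1) = -(b / (n + 1)) := by
    field_simp
    ring
  have e2 : (((n : ℝ) + 1 + b) / (n + 1))⁻¹ - 1 = -(b / (n + 1 + b)) := by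
    field_simp
    ring
  rw [e1, e2] at hs
  push_cast
  linarith

/-! ### Sharpness of the constant -/

theorem tendsto_weighted_rpow_diff_sq (g : ℝ) :
    Tendsto (fun n : ℕ => (((n : ℝ) + 1) ^ g - (n : ℝ) ^ g) ^ 2 * ((n : ℝ) + 1) ^ (1 - 2 * g)
      * ((n : ℝ) + 1)) atTop (𝓝 (g ^ 2)) := by
  have hd : HasDerivAt (fun x : ℝ => x ^ g) g 1 := by
    simpa using Real.hasDerivAt_rpow_const (x := 1) (p := g) (Or.inl one_ne_zero)
  have hs := hasDerivAt_iff_tendsto_slope.1 hd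
  -- By homogeneity the expression is the squared slope of `x ^ g` between `1` and `n / (n + 1)`.
  have ht : Tendsto (fun n : ℕ => (n : ℝ) / (n + 1)) atTop (𝓝[≠] 1) := by
    refine tendsto_nhdsWithin_iff.2 ⟨tendsto_natCast_div_add_atTop 1, .of_forall fun n => ?_⟩
    have : (0 : ℝ) < (n : ℝ) + 1 := by positivity
    simp only [Set.mem_compl_iff, Set.mem_singleton_iff, div_eq_one_iff_eq this.ne']
    linarith
  refine ((hs.comp ht).pow 2).congr fun n => ?_
  have hm : (0 : ℝ) < (n : ℝ) + 1 := by positivity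
  have hg : (0 : ℝ) < ((n : ℝ) + 1) ^ g := Real.rpow_pos_of_pos hm _
  have e : (n : ℝ) / (n + 1) - 1 = -(1 / (n + 1)) := by
    field_simp
    ring
  simp only [Function.comp, slope_def_field, Real.one_rpow]
  rw [Real.div_rpow (by positivity) hm.le, e, Real.rpow_sub hm, Real.rpow_one, two_mul,
    Real.rpow_add hm]
  field_simp
  ring

/-- The truncation of the power `n ^ g`, linear from `N` to `2 * N` and zero afterwards. -/
noncomputable def truncPow (g : ℝ) (N n : ℕ) : ℝ :=
  if n ≤ N then (n : ℝ) ^ g else (N : ℝ) ^ g * ((2 * N - n : ℕ) / N)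

theorem truncPow_of_le {g : ℝ} {N n : ℕ} (h : n ≤ N) : truncPow g N n = (n : ℝ) ^ g := if_pos h

theorem truncPow_of_ge {g : ℝ} {N n : ℕ} (hN : 0 < N) (h : N ≤ n) :
    truncPow g N n = (N : ℝ) ^ g * ((2 * N - n : ℕ) / N) := by
  rcases h.eq_or_lt with rfl | h
  · rw [truncPow_of_le le_rfl, show 2 * N - N = N by omega, div_self (by positivity), mul_one]
  · exact if_neg (by omega)

theorem truncPow_eq_zero {g : ℝ} {N n : ℕ} (hN : 0 < N) (h : 2 * N ≤ n) : truncPow g N n = 0 := by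
  rw [truncPow_of_ge hN (by omega), show 2 * N - n = 0 by omega]
  simp

/-- Each of the `N` squared increments is `N ^ (-α - 1)`, against a weight at most `(2 * N) ^ α`. -/
theorem sum_truncPow_tail_le {α : ℝ} (hα : 0 ≤ α) {N : ℕ} (hN : 0 < N) :
    ∑ k ∈ range N, (truncPow ((1 - α) / 2) N (N + k + 1) - truncPow ((1 - α) / 2) N (N + k)) ^ 2
      * (((N + k : ℕ) : ℝ) + 1) ^ α ≤ 2 ^ α := by
  have hN' : (0 : ℝ) < N := by exact_mod_cast hN
  have hb : ∀ k ∈ range N, (truncPow ((1 - α) / 2) N (N + k + 1)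
      - truncPow ((1 - α) / 2) N (N + k)) ^ 2 * (((N + k : ℕ) : ℝ) + 1) ^ α ≤ 2 ^ α / N := by
    intro k hk
    rw [Finset.mem_range] at hk
    rw [truncPow_of_ge hN (by omega), truncPow_of_ge hN (by omega),
      Nat.cast_sub (by omega), Nat.cast_sub (by omega)]
    have e : ((N : ℝ) ^ ((1 - α) / 2) * ((((2 * N : ℕ) : ℝ) - ((N + k + 1 : ℕ) : ℝ)) / N)
        - (N : ℝ) ^ ((1 - α) / 2) * ((((2 * N : ℕ) : ℝ) - ((N + k : ℕ) : ℝ)) / N)) ^ 2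
        = ((N : ℝ) ^ α)⁻¹ / N := by
      have h1 : ((N : ℝ) ^ ((1 - α) / 2)) ^ 2 = N / (N : ℝ) ^ α := by
        rw [← Real.rpow_natCast, ← Real.rpow_mul hN'.le]
        norm_num
        rw [Real.rpow_sub hN', Real.rpow_one]
      rw [← mul_sub, mul_pow, h1]
      push_cast
      field_simp
      ring
    rw [e]
    have h2 : (((N + k : ℕ) : ℝ) + 1) ^ α ≤ (2 * N) ^ α := by
      refine Real.rpow_le_rpow (by positivity) ?_ hα
      have : N + k + 1 ≤ 2 * N := by omega
      exact_mod_cast this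
    rw [Real.mul_rpow (by norm_num) hN'.le] at h2
    have hp : 0 < (N : ℝ) ^ α := Real.rpow_pos_of_pos hN' _
    calc _ ≤ ((N : ℝ) ^ α)⁻¹ / N * (2 ^ α * (N : ℝ) ^ α) := by gcongr
      _ = _ := by field_simp
  refine (Finset.sum_le_card_nsmul _ _ _ hb).trans_eq ?_
  rw [Finset.card_range, nsmul_eq_mul]
  field_simp

/-- No constant above `(α - 1) ^ 2 / 4` is admissible in the weighted Hardy inequality. -/
theorem hardy_sharp (𝕜 : Type*) [RCLike 𝕜] {α C : ℝ} (hα : 0 ≤ α) (hα1 : α ≠ 1)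
    (hC : (α - 1) ^ 2 / 4 < C) :
    ¬ ∀ u : ℕ →₀ 𝕜, u 0 = 0 →
      C * ∑' n : ℕ, ‖u (n + 1)‖ ^ 2 / ((n : ℝ) + 1) ^ 2 * ((n : ℝ) + 1) ^ α
        ≤ ∑' n : ℕ, ‖u (n + 1) - u n‖ ^ 2 * ((n : ℝ) + 1) ^ α := by
  intro H
  set g : ℝ := (1 - α) / 2 with hg
  have hg0 : g ≠ 0 := fun h => hα1 (by linarith)
  have hgα : 1 - 2 * g = α := by rw [hg]; ring
  have hgC : g ^ 2 < C := by rw [hg]; convert hC using 1; ring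
  obtain ⟨B, hB1, hB2⟩ := exists_between hgC
  have hC0 : 0 ≤ C := (sq_nonneg g).trans hgC.le
  have hlim := tendsto_weighted_rpow_diff_sq g
  rw [hgα] at hlim
  obtain ⟨n₀, hn₀⟩ := eventually_atTop.1 (hlim.eventually (gt_mem_nhds hB1))
  let d : ℕ → ℝ := fun n => (((n : ℝ) + 1) ^ g - (n : ℝ) ^ g) ^ 2 * ((n : ℝ) + 1) ^ α
  have hd0 : ∀ n, 0 ≤ d n := fun n => by positivity
  have hd : ∀ N, ∑ n ∈ range N, d n
      ≤ ∑ n ∈ range n₀, d n + B * ∑ n ∈ range N, 1 / ((n : ℝ) + 1) := by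
    intro N
    induction N with
    | zero => simpa using Finset.sum_nonneg fun n _ => hd0 n
    | succ N ih =>
      have hB0 : 0 ≤ B := (sq_nonneg g).trans hB1.le
      rcases le_or_gt n₀ N with h | h
      · have h1 : d N ≤ B * (1 / ((N : ℝ) + 1)) := by
          rw [mul_one_div, le_div_iff₀ (by positivity)]
          exact (hn₀ N h).le
        rw [Finset.sum_range_succ, Finset.sum_range_succ, mul_add]
        linarith
      · have h1 : ∑ n ∈ range (N + 1), d n ≤ ∑ n ∈ range n₀, d n :=
          Finset.sum_le_sum_of_subset_of_nonneg (Finset.range_mono h) fun n _ _ => hd0 n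
        have h2 : 0 ≤ B * ∑ n ∈ range (N + 1), 1 / ((n : ℝ) + 1) :=
          mul_nonneg hB0 (Finset.sum_nonneg fun n _ => by positivity)
        linarith
  have hmain : ∀ N : ℕ, 0 < N → (C - B) * ∑ n ∈ range N, 1 / ((n : ℝ) + 1)
      ≤ ∑ n ∈ range n₀, d n + 2 ^ α := by
    intro N hN
    let u : ℕ →₀ 𝕜 := Finsupp.onFinset (range (2 * N)) (fun n => ((truncPow g N n : ℝ) : 𝕜)) <| by
      intro n hn
      rw [Finset.mem_range]
      by_contra h
      exact hn (by rw [truncPow_eq_zero hN (by omega), RCLike.ofReal_zero])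
    have hu : ∀ n, u n = ((truncPow g N n : ℝ) : 𝕜) := fun n => rfl
    have hu0 : u 0 = 0 := by
      -- For `g < 0` this uses the convention `0 ^ g = 0`.
      rw [hu, truncPow_of_le (by omega), Nat.cast_zero, Real.zero_rpow hg0, RCLike.ofReal_zero]
    have h := H u hu0
    have hsq : ∀ x : ℝ, ‖(x : 𝕜)‖ ^ 2 = x ^ 2 := fun x => by rw [RCLike.norm_ofReal, sq_abs]
    simp only [hu, ← RCLike.ofReal_sub, hsq] at h
    rw [tsum_eq_sum (s := range (N + N)) (fun n hn => by
        rw [Finset.mem_range, not_lt] at hn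
        rw [truncPow_eq_zero hN (by omega)]
        simp),
      tsum_eq_sum (s := range (N + N)) (fun n hn => by
        rw [Finset.mem_range, not_lt] at hn
        rw [truncPow_eq_zero hN (by omega), truncPow_eq_zero hN (by omega)]
        simp),
      Finset.sum_range_add, Finset.sum_range_add] at h
    have hL : ∑ n ∈ range N, truncPow g N (n + 1) ^ 2 / ((n : ℝ) + 1) ^ 2 * ((n : ℝ) + 1) ^ α
        = ∑ n ∈ range N, 1 / ((n : ℝ) + 1) := by
      refine Finset.sum_congr rfl fun n hn => ?_
      rw [Finset.mem_range] at hn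
      have hm : (0 : ℝ) < (n : ℝ) + 1 := by positivity
      rw [truncPow_of_le hn, ← hgα, Real.rpow_sub hm, Real.rpow_one, two_mul, Real.rpow_add hm]
      have := Real.rpow_pos_of_pos hm g
      push_cast
      field_simp
    have hL' : 0 ≤ ∑ k ∈ range N, truncPow g N (N + k + 1) ^ 2 / (((N + k : ℕ) : ℝ) + 1) ^ 2
        * (((N + k : ℕ) : ℝ) + 1) ^ α := Finset.sum_nonneg fun k _ => by positivity
    have hR : ∑ n ∈ range N, (truncPow g N (n + 1) - truncPow g N n) ^ 2 * ((n : ℝ) + 1) ^ α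
        = ∑ n ∈ range N, d n := by
      refine Finset.sum_congr rfl fun n hn => ?_
      rw [Finset.mem_range] at hn
      rw [truncPow_of_le hn, truncPow_of_le hn.le]
      simp [d]
    rw [hL, hR] at h
    have h1 := mul_nonneg hC0 hL'
    have h2 := sum_truncPow_tail_le hα hN
    have h3 := hd N
    rw [mul_add] at h
    rw [sub_mul]
    linarith
  have hdiv := Real.tendsto_sum_range_one_div_nat_succ_atTop.const_mul_atTop (sub_pos.2 hB2)
  obtain ⟨N, hN, hN0⟩ := ((hdiv.eventually_gt_atTop (∑ n ∈ range n₀, d n + 2 ^ α)).and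
    (eventually_gt_atTop 0)).exists
  exact absurd (hmain N hN0) (not_le.2 hN)

/-- Discrete Hardy inequality with power weights, with sharp constant. The index `n : ℕ` stands for
the summation index `n + 1 ≥ 1`; all series have only finitely many nonzero terms. -/
theorem corollary2p3 {𝕜 : Type*} [RCLike 𝕜] (α : ℝ) (hα : α ∈ Set.Ico (0 : ℝ) 1 ∪ Set.Ici 5) :
    (∀ u : ℕ →₀ 𝕜, u 0 = 0 →
      (α - 1) ^ 2 / 4 * ∑' n : ℕ, ‖u (n + 1)‖ ^ 2 / ((n : ℝ) + 1) ^ 2 * ((n : ℝ) + 1) ^ α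
        ≤ ∑' n : ℕ, ‖u (n + 1) - u n‖ ^ 2 * ((n : ℝ) + 1) ^ α) ∧
    (∀ C : ℝ, (α - 1) ^ 2 / 4 < C →
      ¬ ∀ u : ℕ →₀ 𝕜, u 0 = 0 →
        C * ∑' n : ℕ, ‖u (n + 1)‖ ^ 2 / ((n : ℝ) + 1) ^ 2 * ((n : ℝ) + 1) ^ α
          ≤ ∑' n : ℕ, ‖u (n + 1) - u n‖ ^ 2 * ((n : ℝ) + 1) ^ α) := by
  refine ⟨fun u hu => ?_, fun C hC => ?_⟩
  · rcases hα with ⟨h0, h1⟩ | h5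
    · have h := hardy_ineq_of_lt_one (b := (1 - α) / 2) (by linarith) (by linarith) u hu
      rw [show 1 - 2 * ((1 - α) / 2) = α by ring] at h
      rw [← tsum_mul_left]
      refine le_trans (le_of_eq (tsum_congr fun n => ?_)) h
      ring
    · have h5' : (5 : ℝ) ≤ α := h5
      have h := hardy_ineq_of_ge_two (b := (α - 1) / 2) (by linarith) u hu
      rw [show 1 + 2 * ((α - 1) / 2) = α by ring] at h
      rw [← tsum_mul_left]
      refine le_trans (le_of_eq (tsum_congr fun n => ?_)) h
      ring
  · refine hardy_sharp 𝕜 ?_ ?_ hC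
    · rcases hα with h | h
      · exact h.1
      · exact le_trans (by norm_num) (show (5 : ℝ) ≤ α from h)
    · rintro rfl
      rcases hα with h | h
      · exact absurd h.2 (lt_irrefl _)
      · exact absurd (show (5 : ℝ) ≤ 1 from h) (by norm_num)
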